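/- Let $\mathcal{M}$ be a measurable space (the mark space). Let $\mathcal{N}$ be the set of marked counting measures, i.e. measures $N$ on $\mathbb{R}\times\mathcal{M}$ with values in $\{0,1,2,\dots\}\cup\{\infty\}$ and $N(B\times\mathcal{M})<\infty$ for every bounded Borel set $B\subset\mathbb{R}$. Equip $\mathcal{N}$ with the smallest $\sigma$-algebra $\sigma(\mathcal{N})$ making all maps $N\mapsto N(E)$, $E$ measurable, measurable. A point process is a random element $\Phi$ of $(\mathcal{N},\sigma(\mathcal{N}))$ on a probability space; its law is denoted $P_\Phi$. For $\tau\in\mathbb{R}$ let $\mathcal{T}_\tau$ be the time shift, $(\mathcal{T}_\tau N)(B\times C)=N((B+\tau)\times C)$. The process $\Phi$ is stationary if $P_\Phi(\mathcal{T}_\tau Z)=P_\Phi(Z)$ for all $Z\in\sigma(\mathcal{N})$ and $\tau\in\mathbb{R}$. A stationary $\Phi$ is ergodic if every $Z\in\sigma(\mathcal{N})$ with $\mathcal{T}_\tau Z=Z$ for all $\tau\in\mathbb{R}$ satisfies $P_\Phi(Z)\in\{0,1\}$. The process $\Phi$ is a renewal process with inter-arrival distribution $P^A$ and i.i.d. marks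 of distribution $P^S$ if almost surely $\Phi=\sum_{i\in\mathbb{Z}}\delta_{(T_i,S_i)}$ with $\dots\le T_{-1}\le T_0\le 0<T_1\le T_2\le\dots$, where the inter-arrival times $T_i-T_{i-1}$, $i\neq 1$ (those of the intervals not covering the origin), are i.i.d. with law $P^A$ and independent of $(T_0,T_1)$, and the marks $(S_i)_{i\in\mathbb{Z}}$ are i.i.d. with law $P^S$ and independent of $(T_i)_{i\in\mathbb{Z}}$. Let $\Phi_{1},\dots,\Phi_{K}$ be independent, stationary and ergodic point processes on a common probability space. Suppose that each $\Phi_{k}$ is a renewal process with i.i.d. marks of some distribution $P^S_k$ and with a continuous inter-arrival distribution $P^A_k$ (i.e. $P^A_k$ has no atoms); the distributions may depend on $k$. Then the superposition $\sum_{k=1}^K\Phi_{k}$ is stationary and ergodic. -/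

import Mathlib

open MeasureTheory ProbabilityTheory

namespace PointProc

/-- The space of marked counting measures on `ℝ × M`: measures with values in `{0, 1, 2, …, ∞}`
that give finite mass to `B ×ˢ M` for every bounded Borel set `B ⊆ ℝ`. As a subtype of
`Measure (ℝ × M)` it carries the smallest σ-algebra that makes all evaluation maps `N ↦ N E`,
`E` measurable, measurable. An unmarked point process is the case `M = Unit`. -/
abbrev CountingMeasure (M : Type*) [MeasurableSpace M] : Type _ :=
  {N : Measure (ℝ × M) //
    (∀ E : Set (ℝ × M), MeasurableSet E → ∃ n : ℕ∞, N E = (n : ENNReal)) ∧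
    (∀ B : Set ℝ, MeasurableSet B → Bornology.IsBounded B → N (B ×ˢ Set.univ) < ⊤)}

variable {M : Type*} [MeasurableSpace M]

/-- The motion of time-mark pairs under the time shift by `τ`: a point at time `t` moves to
time `t - τ` and keeps its mark. -/
def movePoint (M : Type*) (τ : ℝ) (x : ℝ × M) : ℝ × M := (x.1 - τ, x.2)

theorem measurable_movePoint (τ : ℝ) : Measurable (movePoint M τ) :=
  (measurable_fst.sub_const τ).prodMk measurable_snd

/-- The time shift `𝒯_τ`, i.e. `(𝒯_τ φ)(t) = φ(t + τ)`; on counting measures,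
`(𝒯_τ N)(B × C) = N((B + τ) × C)`. -/
noncomputable def shift (τ : ℝ) (N : CountingMeasure M) : CountingMeasure M :=
  ⟨N.1.map (movePoint M τ), by
    refine ⟨fun E hE => ?_, fun B hB hb => ?_⟩
    · rw [Measure.map_apply (measurable_movePoint τ) hE]
      exact N.2.1 _ (measurable_movePoint τ hE)
    · rw [Measure.map_apply (measurable_movePoint τ) (hB.prod MeasurableSet.univ)]
      have h : movePoint M τ ⁻¹' (B ×ˢ Set.univ) =
          ((fun t : ℝ => t - τ) ⁻¹' B) ×ˢ (Set.univ : Set M) := by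
        ext x; simp [movePoint]
      rw [h]
      refine N.2.2 _ ((measurable_id.sub_const τ) hB) ?_
      obtain ⟨C, hC⟩ := hb.exists_norm_le
      refine isBounded_iff_forall_norm_le.2 ⟨C + ‖τ‖, fun t ht => ?_⟩
      have h1 := hC _ ht
      have h2 := norm_add_le (t - τ) τ
      rw [sub_add_cancel] at h2
      linarith⟩

/-- The superposition (sum) of finitely many counting measures. -/
noncomputable def superpose {K : ℕ} (N : Fin K → CountingMeasure M) : CountingMeasure M :=
  ⟨∑ k, (N k).1, by
    refine ⟨fun E hE => ?_, fun B hB hb => ?_⟩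
    · choose n hn using fun k => (N k).2.1 E hE
      refine ⟨∑ k, n k, ?_⟩
      rw [Measure.finsetSum_apply]
      simp only [hn]
      exact (map_sum ENat.toENNRealRingHom n Finset.univ).symm
    · rw [Measure.finsetSum_apply]
      exact ENNReal.sum_lt_top.2 fun k _ => (N k).2.2 B hB hb⟩

theorem measurable_superpose {K : ℕ} :
    Measurable (superpose : (Fin K → CountingMeasure M) → CountingMeasure M) := by
  refine Measurable.subtype_mk (Measure.measurable_of_measurable_coe _ fun E hE => ?_)
  simp only [Measure.finsetSum_apply]
  exact Finset.measurable_sum _ fun k _ =>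
    (Measure.measurable_coe hE).comp (measurable_subtype_coe.comp (measurable_pi_apply k))

/-- A (marked) point process on `Ω`: a random element of the space of marked counting
measures. -/
structure PointProcess (Ω : Type*) [MeasurableSpace Ω] (M : Type*) [MeasurableSpace M] where
  toFun : Ω → CountingMeasure M
  measurable_toFun : Measurable toFun

variable {Ω : Type*} [MeasurableSpace Ω]

/-- The distribution of a point process, a measure on the space of counting measures. -/
noncomputable def PointProcess.law (Φ : PointProcess Ω M) (P : Measure Ω) :
    Measure (CountingMeasure M) :=
  P.map Φ.toFun

/-- The superposition `∑ₖ Φₖ` of finitely many point processes. -/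
noncomputable def superposition {K : ℕ} (Φ : Fin K → PointProcess Ω M) : PointProcess Ω M where
  toFun ω := superpose fun k => (Φ k).toFun ω
  measurable_toFun :=
    measurable_superpose.comp (measurable_pi_lambda _ fun k => (Φ k).measurable_toFun)

/-- Stationarity: the distribution is invariant under all time shifts. -/
def PointProcess.IsStationary (Φ : PointProcess Ω M) (P : Measure Ω) : Prop :=
  ∀ Z : Set (CountingMeasure M), MeasurableSet Z → ∀ τ : ℝ,
    Φ.law P (shift τ '' Z) = Φ.law P Z

/-- Ergodicity (of a stationary process): every measurable set of counting measures that is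
invariant under all time shifts has probability `0` or `1`. -/
def PointProcess.IsErgodic (Φ : PointProcess Ω M) (P : Measure Ω) : Prop :=
  ∀ Z : Set (CountingMeasure M), MeasurableSet Z → (∀ τ : ℝ, shift τ '' Z = Z) →
    Φ.law P Z = 0 ∨ Φ.law P Z = 1

/-- `Φ` is a renewal process with inter-arrival distribution `PA` and i.i.d. marks of
distribution `PS`. Its points are `… ≤ T₋₁ ≤ T₀ ≤ 0 < T₁ ≤ T₂ ≤ …` with marks `Sᵢ`. The
inter-arrival times `Aᵢ = Tᵢ - Tᵢ₋₁`, `i ≠ 1`, are i.i.d. of law `PA` and independent of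
`(T₀, T₁)`. The interval `(T₀, T₁]` is the one that covers the origin; its length is not required
to have law `PA` (in a stationary renewal process it is size-biased). The marks are i.i.d. and
independent of the arrival times. -/
def PointProcess.IsRenewal (Φ : PointProcess Ω M) (P : Measure Ω) (PA : Measure ℝ)
    (PS : Measure M) : Prop :=
  ∃ (T : ℤ → Ω → ℝ) (S : ℤ → Ω → M),
    (∀ i, Measurable (T i)) ∧ (∀ i, Measurable (S i)) ∧
    (∀ᵐ ω ∂P, Monotone (fun i => T i ω) ∧ T 0 ω ≤ 0 ∧ 0 < T 1 ω ∧
      (Φ.toFun ω).1 = Measure.sum fun i : ℤ => Measure.dirac (T i ω, S i ω)) ∧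
    (∀ i : ℤ, i ≠ 1 → HasLaw (fun ω => T i ω - T (i - 1) ω) PA P) ∧
    iIndepFun (fun (i : {i : ℤ // i ≠ 1}) ω => T i ω - T (i - 1) ω) P ∧
    IndepFun (fun ω => (T 0 ω, T 1 ω))
      (fun ω (i : {i : ℤ // i ≠ 1}) => T i ω - T (i - 1) ω) P ∧
    (∀ i, HasLaw (S i) PS P) ∧
    iIndepFun S P ∧
    IndepFun (fun ω i => T i ω) (fun ω i => S i ω) P

end PointProc

/-! Superposing commutes with the time shifts, so the superposition is a factor of the joint
process, and it suffices that the joint shift is ergodic. A product of two ergodic flows need not be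
ergodic. The point, used in an induction on `K`, is that multiplying any ergodic flow `T` by a
stationary renewal process with atomless inter-arrival law preserves ergodicity
(`IsErgodicFlow.prod_renewal`).

Seen from its point `0`, the renewal process is a sequence of gaps and marks. Its law is absolutely
continuous with respect to an i.i.d. law, because the one exceptional gap, which covers the origin,
has a law absolutely continuous with respect to `PA` (`absolutelyContinuous_coverInterval`). A
jointly invariant set therefore becomes a set invariant under a skew product: move one index along
the i.i.d. sequence and move `x` along the flow by the gap passed. Such a set is approximated both
by sets of the future steps and by sets of the past steps, which are independent for fixed `x`, so
its sections are null or full (`ae_section_eq_zero_or_one`).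

Hence the set is given, up to null sets, by a set `H` of points `x`, almost invariant under `T a`
for almost every gap length `a`. These `a` form a subgroup of `ℝ`. It carries an atomless
probability, so it is uncountable and hence dense, and continuity of translation in measure makes
`H` trivial. -/

namespace PointProc
-- Sets of reals almost invariant under dense translations
open Set Filter Topology
open scoped symmDiff

/-- A measurable set of reals that is almost invariant under a dense set of translations is null
or conull. -/
theorem ae_mem_or_ae_notMem_of_dense_translations {s D : Set ℝ} (hs : MeasurableSet s)
    (hD : Dense D) (h : ∀ t ∈ D, ∀ᵐ x : ℝ, t + x ∈ s ↔ x ∈ s) :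
    (∀ᵐ x : ℝ, x ∈ s) ∨ ∀ᵐ x : ℝ, x ∉ s := by
  let f : ℝ → C(ℝ, ℝ) := fun t => ⟨fun x => t + x, by fun_prop⟩
  have hf : Continuous f := by
    refine ContinuousMap.continuous_of_continuous_uncurry f ?_
    simp only [Function.uncurry_def, f, ContinuousMap.coe_mk]
    fun_prop
  have hfm : ∀ t, MeasurePreserving (f t) (volume : Measure ℝ) volume :=
    fun t => measurePreserving_add_left volume t
  -- Truncation to `[-n, n]` gives finite measure, which continuity of translation in measure
  -- requires. The estimate is one-sided because the truncated set is itself not almost invariant.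
  have key : ∀ (t : ℝ) (n : ℕ), volume ((f t ⁻¹' (s ∩ Icc (-n : ℝ) n)) ∩ sᶜ) = 0 := by
    intro t n
    have hfin : volume (s ∩ Icc (-n : ℝ) n) ≠ ⊤ :=
      ((measure_mono inter_subset_right).trans_lt (by simp)).ne
    have hms := hs.inter (measurableSet_Icc (a := (-n : ℝ)) (b := n))
    obtain ⟨u, hu, hut⟩ := mem_closure_iff_seq_limit.1 (hD t)
    have hlim := tendsto_measure_symmDiff_preimage_nhds_zero
      ((hf.tendsto t).comp hut) (.of_forall fun k => hfm (u k)) (hfm t)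
      hms.nullMeasurableSet hfin
    refine le_antisymm (ge_of_tendsto hlim (.of_forall fun k => ?_)) zero_le
    have h0 : volume ((f (u k) ⁻¹' s) ∩ sᶜ) = 0 :=
      measure_eq_zero_iff_ae_notMem.2 ((h (u k) (hu k)).mono fun x hx hx' => hx'.2 (hx.1 hx'.1))
    calc volume ((f t ⁻¹' (s ∩ Icc (-n : ℝ) n)) ∩ sᶜ)
        ≤ volume (((f (u k) ⁻¹' s) ∩ sᶜ) ∪ ((f (u k) ⁻¹' (s ∩ Icc (-n : ℝ) n)) ∆
            (f t ⁻¹' (s ∩ Icc (-n : ℝ) n)))) := by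
          refine measure_mono fun x hx => ?_
          by_cases hk : x ∈ f (u k) ⁻¹' (s ∩ Icc (-n : ℝ) n)
          · exact Or.inl ⟨hk.1, hx.2⟩
          · exact Or.inr (Or.inr ⟨hx.1, hk⟩)
      _ ≤ _ := (measure_union_le _ _).trans (by rw [h0, zero_add]; rfl)
  have key2 : ∀ t : ℝ, ∀ᵐ x : ℝ, t + x ∈ s → x ∈ s := by
    intro t
    have := ae_all_iff.2 fun n => measure_eq_zero_iff_ae_notMem.1 (key t n)
    filter_upwards [this] with x hx hxs
    by_contra hxn
    obtain ⟨n, hn⟩ := exists_nat_ge |t + x|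
    exact hx n ⟨⟨hxs, abs_le.1 hn⟩, hxn⟩
  have key3 : ∀ t : ℝ, (fun x => t +ᵥ x) ⁻¹' s =ᵐ[volume] s := by
    intro t
    have h2 := (quasiMeasurePreserving_add_left (volume : Measure ℝ) t).ae (key2 (-t))
    refine eventuallyEq_set.2 ?_
    filter_upwards [key2 t, h2] with x h1 h2
    exact ⟨h1, fun hx => h2 (by simpa using hx)⟩
  have := aeconst_of_forall_preimage_vadd_ae_eq ℝ hs.nullMeasurableSet key3
  exact eventuallyConst_set.1 this

/-! ### Ergodic flows and almost invariant sets -/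

variable {X : Type*} [MeasurableSpace X]

/-- A measurable, measure-preserving flow of a probability space whose strictly invariant
measurable sets are trivial. -/
structure IsErgodicFlow (T : ℝ → X → X) (μ : Measure X) : Prop where
  measurable : Measurable fun p : ℝ × X => T p.1 p.2
  zero : ∀ x, T 0 x = x
  add : ∀ s t x, T (s + t) x = T s (T t x)
  preserving : ∀ t, MeasurePreserving (T t) μ μ
  ergodic : ∀ A : Set X, MeasurableSet A → (∀ t, T t ⁻¹' A = A) → μ A = 0 ∨ μ A = 1

variable {T : ℝ → X → X} {μ : Measure X} [IsProbabilityMeasure μ]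

/-- The flow need not be continuous; Fubini transfers the question to the times at which an orbit
visits `H`, where continuity of translation on the real line is available. -/
theorem IsErgodicFlow.ae_mem_or_ae_notMem_of_dense (hT : IsErgodicFlow T μ) {H : Set X}
    (hH : MeasurableSet H) {D : Set ℝ} (hD : Dense D)
    (h : ∀ t ∈ D, ∀ᵐ x ∂μ, T t x ∈ H ↔ x ∈ H) :
    (∀ᵐ x ∂μ, x ∈ H) ∨ ∀ᵐ x ∂μ, x ∉ H := by
  -- Countability allows one exceptional null set of `x` for all translations at once.
  obtain ⟨C, hCD, hCc, hC⟩ := hD.exists_countable_dense_subset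
  have hmeas : MeasurableSet {p : X × ℝ | T p.2 p.1 ∈ H} :=
    (hT.measurable.comp measurable_swap) hH
  have hsec : ∀ᵐ x ∂μ, (∀ᵐ s : ℝ, T s x ∈ H) ∨ ∀ᵐ s : ℝ, T s x ∉ H := by
    have : ∀ᵐ x ∂μ, ∀ t ∈ C, ∀ᵐ s : ℝ, T (t + s) x ∈ H ↔ T s x ∈ H := by
      refine (ae_ball_iff hCc).2 fun t ht => ?_
      have h1 : ∀ᵐ s : ℝ, ∀ᵐ x ∂μ, T (t + s) x ∈ H ↔ T s x ∈ H := by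
        refine .of_forall fun s => ?_
        filter_upwards [(hT.preserving s).quasiMeasurePreserving.ae (h t (hCD ht))] with x hx
        rw [hT.add, hx]
      refine (Measure.ae_ae_comm ?_).1 h1
      have m1 : MeasurableSet {p : ℝ × X | T (t + p.1) p.2 ∈ H} := by
        have : Measurable fun p : ℝ × X => T (t + p.1) p.2 :=
          hT.measurable.comp ((measurable_fst.const_add t).prodMk measurable_snd)
        exact this hH
      exact m1.iff (hT.measurable hH)
    filter_upwards [this] with x hx
    exact ae_mem_or_ae_notMem_of_dense_translations (s := {s | T s x ∈ H})
      (measurable_prodMk_left hmeas) hC hx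
  have hfub : ∀ B : Set X, MeasurableSet B → (∀ᵐ x ∂μ, ∀ᵐ s : ℝ, T s x ∈ B) → ∀ᵐ x ∂μ, x ∈ B := by
    intro B hB hx
    have h1 : ∀ᵐ s : ℝ, ∀ᵐ x ∂μ, T s x ∈ B :=
      (Measure.ae_ae_comm (p := fun x s => T s x ∈ B) ((hT.measurable.comp measurable_swap) hB)).1 hx
    obtain ⟨s, hs⟩ := h1.exists
    rw [← (hT.preserving s).map_eq]
    exact (ae_map_iff (hT.preserving s).measurable.aemeasurable hB).2 hs
  -- Ergodicity speaks of strictly invariant sets only. This version of `H` is strictly invariant,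
  -- since Lebesgue null sets of times are translation invariant.
  have hmeas' : MeasurableSet {x : X | ∀ᵐ s : ℝ, T s x ∈ H} := by
    have := measurable_measure_prodMk_left (ν := (volume : Measure ℝ)) hmeas.compl
    exact this (measurableSet_singleton 0)
  have hinv : ∀ t, T t ⁻¹' {x : X | ∀ᵐ s : ℝ, T s x ∈ H} = {x : X | ∀ᵐ s : ℝ, T s x ∈ H} := by
    intro t
    ext x
    simp only [mem_preimage, mem_ofPred_eq, ← hT.add]
    constructor
    · intro hx
      have := (quasiMeasurePreserving_add_right (volume : Measure ℝ) (-t)).ae hx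
      simpa using this
    · intro hx
      exact (quasiMeasurePreserving_add_right (volume : Measure ℝ) t).ae hx
  rcases hT.ergodic _ hmeas' hinv with h0 | h1
  · refine Or.inr (hfub Hᶜ hH.compl ?_)
    filter_upwards [hsec, measure_eq_zero_iff_ae_notMem.1 h0] with x hx hx'
    exact hx.resolve_left hx'
  · exact Or.inl (hfub H hH ((prob_compl_eq_zero_iff hmeas').2 h1))

/-- If a measurable set is almost invariant under `T a` for almost all `a` with respect to an
atomless distribution, then it is trivial. -/
theorem IsErgodicFlow.ae_mem_or_ae_notMem_of_atomless (hT : IsErgodicFlow T μ) {H : Set X}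
    (hH : MeasurableSet H) {ρ : Measure ℝ} [IsProbabilityMeasure ρ] (hρ : ∀ t, ρ {t} = 0)
    (h : ∀ᵐ a ∂ρ, ∀ᵐ x ∂μ, T a x ∈ H ↔ x ∈ H) :
    (∀ᵐ x ∂μ, x ∈ H) ∨ ∀ᵐ x ∂μ, x ∉ H := by
  let G : AddSubgroup ℝ :=
    { carrier := {a | ∀ᵐ x ∂μ, T a x ∈ H ↔ x ∈ H}
      zero_mem' := by
        refine Eventually.of_forall (f := ae μ) fun x => ?_
        rw [hT.zero]
      add_mem' := by
        intro a b ha hb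
        filter_upwards [hb, (hT.preserving b).quasiMeasurePreserving.ae ha] with x h1 h2
        rw [hT.add, h2, h1]
      neg_mem' := by
        intro a ha
        filter_upwards [(hT.preserving (-a)).quasiMeasurePreserving.ae ha] with x h2
        rw [← h2, ← hT.add, add_neg_cancel, hT.zero] }
  have hGρ : ∀ᵐ a ∂ρ, a ∈ (G : Set ℝ) := h
  have : NullSingletonClass ρ := ⟨hρ⟩
  rcases G.dense_or_cyclic with hd | ⟨a, ha⟩
  · exact hT.ae_mem_or_ae_notMem_of_dense hH hd fun t ht => ht
  · exfalso
    have hc : (G : Set ℝ).Countable := by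
      rw [ha, ← AddSubgroup.zmultiples_eq_closure, AddSubgroup.coe_zmultiples]
      exact countable_range _
    have h1 := hc.measure_zero ρ
    have h2 : ρ univ = 0 := by
      rw [← union_compl_self (G : Set ℝ)]
      exact measure_union_null h1 hGρ
    simp at h2

end PointProc

/-! ### Positions as two-sided partial sums of gaps -/

namespace PointProc
open Set Filter Topology
open scoped symmDiff ENNReal

/-- The two-sided partial sums of the gaps `a`: the position of the `i`-th point when the `0`-th
point is at the origin and `a i` is the distance from point `i` to point `i + 1`. -/
noncomputable def position (a : ℤ → ℝ) (i : ℤ) : ℝ :=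
  ∑ j ∈ Finset.Ico 0 i, a j - ∑ j ∈ Finset.Ico i 0, a j

@[simp] theorem position_zero (a : ℤ → ℝ) : position a 0 = 0 := by simp [position]

theorem position_add_one (a : ℤ → ℝ) (i : ℤ) : position a (i + 1) = position a i + a i := by
  unfold position
  rcases le_or_gt 0 i with hi | hi
  · rw [Finset.Ico_eq_empty_of_le (by lia : (0 : ℤ) ≤ i + 1), Finset.Ico_eq_empty_of_le hi,
      ← Finset.insert_Ico_right_eq_Ico_add_one hi, Finset.sum_insert (by simp)]
    simp [add_comm]
  · rw [Finset.Ico_eq_empty_of_le (by lia : i + 1 ≤ (0 : ℤ)), Finset.Ico_eq_empty_of_le hi.le,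
      ← Finset.insert_Ico_add_one_left_eq_Ico hi, Finset.sum_insert (by simp)]
    simp

theorem eq_add_position {t a : ℤ → ℝ} (h : ∀ i, t (i + 1) = t i + a i) (i : ℤ) :
    t i = t 0 + position a i := by
  induction i using Int.induction_on with
  | zero => simp
  | succ i ih => rw [h, ih, position_add_one, add_assoc]
  | pred i ih =>
    have h1 := h (-(i : ℤ) - 1)
    have h2 := position_add_one a (-(i : ℤ) - 1)
    rw [sub_add_cancel] at h1 h2
    linarith

theorem position_comp_add (a : ℤ → ℝ) (m i : ℤ) :
    position (fun j => a (j + m)) i = position a (i + m) - position a m := by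
  have h := eq_add_position (t := fun i => position a (i + m)) (a := fun j => a (j + m))
    (fun i => by
      have : i + 1 + m = i + m + 1 := by ring
      rw [this, position_add_one]) i
  simp only [zero_add] at h
  linarith

/-! ### Coordinate σ-algebras and the skew product over an i.i.d. sequence -/

variable {E : Type*} [mE : MeasurableSpace E] {X : Type*} [mX : MeasurableSpace X]

/-- The σ-algebra on sequences generated by the coordinates in `I`. -/
@[reducible] def coordSigma (E : Type*) [MeasurableSpace E] (I : Set ℤ) : MeasurableSpace (ℤ → E) :=
  ⨆ i ∈ I, MeasurableSpace.comap (fun w : ℤ → E => w i) inferInstance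

theorem coordSigma_mono {I J : Set ℤ} (h : I ⊆ J) : coordSigma E I ≤ coordSigma E J :=
  biSup_mono h

theorem coordSigma_le (I : Set ℤ) : coordSigma E I ≤ MeasurableSpace.pi :=
  iSup₂_le fun i _ => (measurable_pi_apply i).comap_le

theorem measurable_coord {I : Set ℤ} {i : ℤ} (hi : i ∈ I) :
    Measurable[coordSigma E I] fun w : ℤ → E => w i :=
  measurable_iff_comap_le.2
    (le_iSup₂_of_le (f := fun i (_ : i ∈ I) =>
      MeasurableSpace.comap (fun w : ℤ → E => w i) inferInstance) i hi le_rfl)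

theorem measurable_to_coordSigma {Y : Type*} {mY : MeasurableSpace Y} {I : Set ℤ} {f : Y → ℤ → E}
    (hf : ∀ i ∈ I, Measurable fun y => f y i) : Measurable[mY, coordSigma E I] f := by
  rw [measurable_iff_comap_le, coordSigma, MeasurableSpace.comap_iSup]
  refine iSup_le fun i => ?_
  rw [MeasurableSpace.comap_iSup]
  refine iSup_le fun hi => ?_
  rw [MeasurableSpace.comap_comp]
  exact (hf i hi).comap_le

theorem measurable_position {Y : Type*} {mY : MeasurableSpace Y} {f : Y → ℤ → ℝ} {m : ℤ}
    (hf : ∀ j, (0 ≤ j ∧ j < m ∨ m ≤ j ∧ j < 0) → Measurable fun y => f y j) :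
    Measurable fun y => position (f y) m := by
  unfold position
  refine (Finset.measurable_sum _ fun j hj => hf j (Or.inl ?_)).sub
    (Finset.measurable_sum _ fun j hj => hf j (Or.inr ?_))
  · simpa using hj
  · simpa using hj

/-- Move the sequence of `E`-valued steps by `m` indices, and the point of `X` along the flow by
the total length of the steps passed. -/
noncomputable def skewShift (g : E → ℝ) (T : ℝ → X → X) (m : ℤ) (p : (ℤ → E) × X) : (ℤ → E) × X :=
  (fun i => p.1 (i + m), T (position (fun i => g (p.1 i)) m) p.2)

variable {T : ℝ → X → X} {μ : Measure X} {g : E → ℝ}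

/-- `hIJ` covers the coordinates read by the shifted sequence, `hJ` the steps summed in the
displacement along the flow. -/
theorem measurable_skewShift_coordSigma (hT : Measurable fun p : ℝ × X => T p.1 p.2)
    (hg : Measurable g) {I J : Set ℤ} {m : ℤ} (hIJ : ∀ i ∈ I, i + m ∈ J)
    (hJ : ∀ j, (0 ≤ j ∧ j < m ∨ m ≤ j ∧ j < 0) → j ∈ J) :
    Measurable[(coordSigma E J).prod mX, (coordSigma E I).prod mX] (skewShift g T m) := by
  let mJ : MeasurableSpace (ℤ → E) := coordSigma E J
  have h1 : Measurable[mJ.prod mX, coordSigma E I]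
      (fun p : (ℤ → E) × X => fun i => p.1 (i + m)) :=
    measurable_to_coordSigma fun i hi => (measurable_coord (hIJ i hi)).comp measurable_fst
  have h2 : Measurable[mJ.prod mX] (fun p : (ℤ → E) × X => position (fun i => g (p.1 i)) m) :=
    measurable_position fun j hj => hg.comp ((measurable_coord (hJ j hj)).comp measurable_fst)
  have h3 : Measurable[mJ.prod mX]
      (fun p : (ℤ → E) × X => T (position (fun i => g (p.1 i)) m) p.2) :=
    hT.comp (h2.prodMk measurable_snd)
  exact @Measurable.prodMk _ (mJ.prod mX) _ _ (coordSigma E I) mX _ _ h1 h3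

/-- The index shift preserves the i.i.d. law, and for each fixed sequence the second component moves
by a single map of the flow. -/
theorem measurePreserving_skewShift [IsProbabilityMeasure μ] (hT : IsErgodicFlow T μ)
    (hg : Measurable g) (ν : Measure E) [IsProbabilityMeasure ν] (m : ℤ) :
    MeasurePreserving (skewShift g T m) ((Measure.infinitePi fun _ : ℤ => ν).prod μ)
      ((Measure.infinitePi fun _ : ℤ => ν).prod μ) := by
  have h1 : MeasurePreserving (fun (w : ℤ → E) i => w (i + m)) (Measure.infinitePi fun _ : ℤ => ν)
      (Measure.infinitePi fun _ : ℤ => ν) :=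
    ⟨measurable_pi_lambda _ fun i => measurable_pi_apply _,
      Measure.map_infinitePi_infinitePi_of_inj (P := fun _ : ℤ => ν) (add_left_injective m)⟩
  refine h1.skew_product (g := fun w x => T (position (fun i => g (w i)) m) x) ?_
    (.of_forall fun w => (hT.preserving _).map_eq)
  refine hT.measurable.comp (Measurable.prodMk ?_ measurable_snd)
  exact measurable_position fun j _ => hg.comp ((measurable_pi_apply j).comp measurable_fst)

theorem indep_coordSigma (ν : Measure E) [IsProbabilityMeasure ν] {I J : Set ℤ}
    (h : Disjoint I J) :
    Indep (coordSigma E I) (coordSigma E J) (Measure.infinitePi fun _ : ℤ => ν) := by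
  refine indep_iSup_of_disjoint (fun i => (measurable_pi_apply i).comap_le) ?_ h
  exact (iIndepFun_iff_iIndep _ _ _).1 (iIndepFun_infinitePi (P := fun _ : ℤ => ν)
    (X := fun _ e => e) fun _ => measurable_id)

/-- Sets in the product of the sequence space with `X` which depend on finitely many coordinates
of the sequence. -/
def finiteWindowSets (E X : Type*) [MeasurableSpace E] [mX : MeasurableSpace X] :
    Set (Set ((ℤ → E) × X)) :=
  {B | ∃ n : ℕ, MeasurableSet[(coordSigma E (Icc (-n : ℤ) n)).prod mX] B}

theorem prod_coordSigma_mono {I J : Set ℤ} (h : I ⊆ J) :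
    (coordSigma E I).prod mX ≤ (coordSigma E J).prod mX :=
  sup_le_sup_right (MeasurableSpace.comap_mono (coordSigma_mono h)) _

theorem prod_coordSigma_le (I : Set ℤ) :
    (coordSigma E I).prod mX ≤ (MeasurableSpace.pi : MeasurableSpace (ℤ → E)).prod mX :=
  sup_le_sup_right (MeasurableSpace.comap_mono (coordSigma_le I)) _

theorem isSetAlgebra_finiteWindowSets : IsSetAlgebra (finiteWindowSets E X) where
  empty_mem := ⟨0, @MeasurableSet.empty _ ((coordSigma E _).prod mX)⟩
  compl_mem := fun _ ⟨n, hn⟩ => ⟨n, hn.compl⟩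
  union_mem := by
    rintro s t ⟨n, hn⟩ ⟨k, hk⟩
    refine ⟨max n k, MeasurableSet.union (prod_coordSigma_mono ?_ _ hn)
      (prod_coordSigma_mono ?_ _ hk)⟩
    · exact Icc_subset_Icc (by push_cast; lia) (by push_cast; lia)
    · exact Icc_subset_Icc (by push_cast; lia) (by push_cast; lia)

theorem generateFrom_finiteWindowSets :
    (inferInstance : MeasurableSpace ((ℤ → E) × X)) =
      MeasurableSpace.generateFrom (finiteWindowSets E X) := by
  refine le_antisymm (sup_le ?_ ?_) (MeasurableSpace.generateFrom_le ?_)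
  · rw [MeasurableSpace.pi, MeasurableSpace.comap_iSup]
    refine iSup_le fun i => ?_
    rw [MeasurableSpace.comap_comp]
    rintro _ ⟨s, hs, rfl⟩
    refine MeasurableSpace.measurableSet_generateFrom ⟨i.natAbs, ?_⟩
    let mI := coordSigma E (Icc (-(i.natAbs : ℤ)) i.natAbs)
    have h1 : Measurable[mI] fun w : ℤ → E => w i := measurable_coord ⟨by lia, by lia⟩
    exact (h1.comp measurable_fst) hs
  · rintro _ ⟨s, hs, rfl⟩
    refine MeasurableSpace.measurableSet_generateFrom ⟨0, ?_⟩
    exact @measurable_snd _ _ (coordSigma E _) mX _ hs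
  · rintro s ⟨n, hn⟩
    exact prod_coordSigma_le _ _ hn

/-- A set invariant under the skew shifts is approximated by sets that depend only on the steps
in a given half line. -/
theorem exists_approx_halfLines [IsProbabilityMeasure μ] (hT : IsErgodicFlow T μ)
    (hg : Measurable g) (ν : Measure E) [IsProbabilityMeasure ν] {A : Set ((ℤ → E) × X)}
    (hA : MeasurableSet A) (hinv : ∀ m, skewShift g T m ⁻¹' A = A) {ε : ℝ} (hε : 0 < ε) :
    ∃ U V, MeasurableSet[(coordSigma E (Ici 0)).prod mX] U ∧
      MeasurableSet[(coordSigma E (Iio 0)).prod mX] V ∧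
      ((Measure.infinitePi fun _ : ℤ => ν).prod μ) (A ∆ U) ≤ ENNReal.ofReal ε ∧
      ((Measure.infinitePi fun _ : ℤ => ν).prod μ) (A ∆ V) ≤ ENNReal.ofReal ε := by
  obtain ⟨B, ⟨n, hn⟩, hB⟩ := (Measure.MeasureDense.of_generateFrom_isSetAlgebra_finite
    (μ := (Measure.infinitePi fun _ : ℤ => ν).prod μ) isSetAlgebra_finiteWindowSets
    generateFrom_finiteWindowSets).approx A hA (measure_ne_top _ _) ε hε
  have hBm : MeasurableSet B := prod_coordSigma_le _ _ hn
  have hm : ∀ m, ((Measure.infinitePi fun _ : ℤ => ν).prod μ) (A ∆ (skewShift g T m ⁻¹' B)) ≤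
      ENNReal.ofReal ε := by
    intro m
    nth_rewrite 1 [← hinv m]
    rw [← preimage_symmDiff, (measurePreserving_skewShift hT hg ν m).measure_preimage
      (hA.symmDiff hBm).nullMeasurableSet]
    exact hB.le
  -- The window `[-n, n]` moves to `[0, 2n]`, respectively `[-2n-1, -1]`. The steps summed in the
  -- displacement have indices in `[0, n)`, respectively `[-(n+1), 0)`, hence in the same half line.
  refine ⟨skewShift g T n ⁻¹' B, skewShift g T (-(n + 1)) ⁻¹' B, ?_, ?_, hm _, hm _⟩
  · refine measurable_skewShift_coordSigma hT.measurable hg (I := Icc (-n : ℤ) n) ?_ ?_ hn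
    · rintro i ⟨h1, h2⟩
      exact mem_Ici.2 (by lia)
    · intro j hj
      exact mem_Ici.2 (by lia)
  · refine measurable_skewShift_coordSigma hT.measurable hg (I := Icc (-n : ℤ) n) ?_ ?_ hn
    · rintro i ⟨h1, h2⟩
      exact mem_Iio.2 (by lia)
    · intro j hj
      exact mem_Iio.2 (by lia)

/-- If `A` is close to two independent sets, it is nearly independent of itself. -/
theorem abs_sub_sq_le_of_indep {Y : Type*} [MeasurableSpace Y] (Q : Measure Y)
    [IsProbabilityMeasure Q] {A U V : Set Y} (hA : MeasurableSet A) (hU : MeasurableSet U)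
    (hV : MeasurableSet V) (h : Q (U ∩ V) = Q U * Q V) :
    |Q.real A - Q.real A ^ 2| ≤ 2 * (Q.real (A ∆ U) + Q.real (A ∆ V)) := by
  have h' : Q.real (U ∩ V) = Q.real U * Q.real V := by simp [Measure.real, h]
  have h1 : |Q.real A - Q.real (U ∩ V)| ≤ Q.real (A ∆ U) + Q.real (A ∆ V) := by
    refine (abs_measureReal_sub_le_measureReal_symmDiff hA.nullMeasurableSet
      (hU.inter hV).nullMeasurableSet).trans ?_
    refine (measureReal_mono ?_).trans (measureReal_union_le _ _)
    intro x
    simp only [mem_symmDiff, mem_inter_iff, mem_union]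
    tauto
  have h2 := abs_measureReal_sub_le_measureReal_symmDiff (μ := Q)
    hA.nullMeasurableSet hU.nullMeasurableSet
  have h3 := abs_measureReal_sub_le_measureReal_symmDiff (μ := Q)
    hA.nullMeasurableSet hV.nullMeasurableSet
  have a0 : 0 ≤ Q.real A := measureReal_nonneg
  have a1 : Q.real A ≤ 1 := measureReal_le_one
  have b0 : 0 ≤ Q.real U := measureReal_nonneg
  have b1 : Q.real U ≤ 1 := measureReal_le_one
  have h4 : |Q.real U * Q.real V - Q.real A ^ 2| ≤ Q.real (A ∆ U) + Q.real (A ∆ V) := by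
    have : Q.real U * Q.real V - Q.real A ^ 2 =
        -((Q.real A - Q.real U) * Q.real A) - Q.real U * (Q.real A - Q.real V) := by ring
    rw [this]
    refine (abs_sub _ _).trans ?_
    rw [abs_neg, abs_mul, abs_mul, abs_of_nonneg a0, abs_of_nonneg b0]
    have := abs_nonneg (Q.real A - Q.real U)
    have := abs_nonneg (Q.real A - Q.real V)
    nlinarith
  have h5 : Q.real A - Q.real A ^ 2 = (Q.real A - Q.real (U ∩ V)) +
    (Q.real U * Q.real V - Q.real A ^ 2) := by rw [h']; ring
  rw [h5]
  refine (abs_add_le _ _).trans ?_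
  linarith

/-- The sections of a set invariant under the skew shifts have probability `0` or `1`. -/
theorem ae_section_eq_zero_or_one [IsProbabilityMeasure μ] (hT : IsErgodicFlow T μ)
    (hg : Measurable g) (ν : Measure E) [IsProbabilityMeasure ν] {A : Set ((ℤ → E) × X)}
    (hA : MeasurableSet A) (hinv : ∀ m, skewShift g T m ⁻¹' A = A) :
    ∀ᵐ x ∂μ, (Measure.infinitePi fun _ : ℤ => ν) ((fun w => (w, x)) ⁻¹' A) = 0 ∨
      (Measure.infinitePi fun _ : ℤ => ν) ((fun w => (w, x)) ⁻¹' A) = 1 := by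
  set Q := Measure.infinitePi fun _ : ℤ => ν with hQ
  have hsec : ∀ {B : Set ((ℤ → E) × X)}, MeasurableSet B → ∀ x,
      MeasurableSet ((fun w => (w, x)) ⁻¹' B) := fun hB x => measurable_prodMk_right hB
  have hmeas : Measurable fun x => ENNReal.ofReal
      |Q.real ((fun w => (w, x)) ⁻¹' A) - Q.real ((fun w => (w, x)) ⁻¹' A) ^ 2| := by
    have h0 : Measurable fun x => Q.real ((fun w => (w, x)) ⁻¹' A) :=
      (measurable_measure_prodMk_right hA).ennreal_toReal
    have h1 := h0.sub (h0.pow_const 2)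
    exact ENNReal.measurable_ofReal.comp (continuous_abs.measurable.comp h1)
  have hint : ∫⁻ x, ENNReal.ofReal
      |Q.real ((fun w => (w, x)) ⁻¹' A) - Q.real ((fun w => (w, x)) ⁻¹' A) ^ 2| ∂μ = 0 := by
    refine le_antisymm (ENNReal.le_of_forall_pos_le_add fun ε hε _ => ?_) zero_le
    obtain ⟨U, V, hU, hV, hAU, hAV⟩ := exists_approx_halfLines hT hg ν hA hinv
      (ε := (ε / 4 : ℝ)) (by positivity)
    have hUm : MeasurableSet U := prod_coordSigma_le _ _ hU
    have hVm : MeasurableSet V := prod_coordSigma_le _ _ hV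
    have hpt : ∀ x, ENNReal.ofReal
        |Q.real ((fun w => (w, x)) ⁻¹' A) - Q.real ((fun w => (w, x)) ⁻¹' A) ^ 2| ≤
        2 * (Q ((fun w => (w, x)) ⁻¹' (A ∆ U)) + Q ((fun w => (w, x)) ⁻¹' (A ∆ V))) := by
      intro x
      -- Both sets may depend on the common point `x`, so independence holds only after fixing it;
      -- this is why the zero-one law concerns sections.
      have hind : Q ((fun w => (w, x)) ⁻¹' U ∩ (fun w => (w, x)) ⁻¹' V) =
          Q ((fun w => (w, x)) ⁻¹' U) * Q ((fun w => (w, x)) ⁻¹' V) := by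
        refine (Indep_iff _ _ _).1 (indep_coordSigma ν (I := Ici 0) (J := Iio 0) ?_) _ _ ?_ ?_
        · exact disjoint_left.2 fun i hi hi' => absurd (mem_Iio.1 hi') (not_lt.2 hi)
        · exact @measurable_prodMk_right _ _ (coordSigma E (Ici 0)) mX x _ hU
        · exact @measurable_prodMk_right _ _ (coordSigma E (Iio 0)) mX x _ hV
      have := abs_sub_sq_le_of_indep Q (hsec hA x) (hsec hUm x) (hsec hVm x) hind
      refine (ENNReal.ofReal_le_ofReal this).trans (le_of_eq ?_)
      rw [ENNReal.ofReal_mul (by norm_num), ENNReal.ofReal_add measureReal_nonneg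
        measureReal_nonneg, ofReal_measureReal, ofReal_measureReal]
      simp [preimage_symmDiff]
    calc ∫⁻ x, ENNReal.ofReal
          |Q.real ((fun w => (w, x)) ⁻¹' A) - Q.real ((fun w => (w, x)) ⁻¹' A) ^ 2| ∂μ
        ≤ ∫⁻ x, 2 * (Q ((fun w => (w, x)) ⁻¹' (A ∆ U)) +
            Q ((fun w => (w, x)) ⁻¹' (A ∆ V))) ∂μ := lintegral_mono hpt
      _ = 2 * (Q.prod μ (A ∆ U) + Q.prod μ (A ∆ V)) := by
          have hadd : Measurable fun x => Q ((fun w => (w, x)) ⁻¹' (A ∆ U)) +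
              Q ((fun w => (w, x)) ⁻¹' (A ∆ V)) :=
            (measurable_measure_prodMk_right (hA.symmDiff hUm)).add
              (measurable_measure_prodMk_right (hA.symmDiff hVm))
          rw [lintegral_const_mul _ hadd, lintegral_add_left (measurable_measure_prodMk_right (hA.symmDiff hUm)),
            Measure.prod_apply_symm (hA.symmDiff hUm), Measure.prod_apply_symm (hA.symmDiff hVm)]
      _ ≤ 2 * (ENNReal.ofReal (ε / 4) + ENNReal.ofReal (ε / 4)) := by gcongr
      _ = 0 + ε := by
          rw [← ENNReal.ofReal_add (by positivity) (by positivity), zero_add]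
          have : (2 : ℝ≥0∞) = ENNReal.ofReal 2 := by simp
          rw [this, ← ENNReal.ofReal_mul (by norm_num), ← ENNReal.ofReal_coe_nnreal]
          congr 1
          ring
  filter_upwards [(lintegral_eq_zero_iff hmeas).1 hint] with x hx
  have hx' : Q.real ((fun w => (w, x)) ⁻¹' A) * (1 - Q.real ((fun w => (w, x)) ⁻¹' A)) = 0 := by
    have h1 := abs_nonpos_iff.1 (ENNReal.ofReal_eq_zero.1 hx)
    linear_combination h1
  rcases mul_eq_zero.1 hx' with h | h
  · exact Or.inl ((measureReal_eq_zero_iff).1 h)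
  · right
    have h1 : Q.real ((fun w => (w, x)) ⁻¹' A) = 1 := by linarith
    rw [← ofReal_measureReal, h1, ENNReal.ofReal_one]

/-- The skew product of a two-sided sequence of independent steps with an ergodic flow is ergodic
as soon as the distribution of the step length has no atoms. -/
theorem ae_mem_or_ae_notMem_of_skewShift_invariant [IsProbabilityMeasure μ]
    (hT : IsErgodicFlow T μ) (hg : Measurable g) (ν : Measure E) [IsProbabilityMeasure ν]
    (hν : ∀ t, ν.map g {t} = 0) {A : Set ((ℤ → E) × X)} (hA : MeasurableSet A)
    (hinv : ∀ m, skewShift g T m ⁻¹' A = A) :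
    (∀ᵐ p ∂(Measure.infinitePi fun _ : ℤ => ν).prod μ, p ∈ A) ∨
      ∀ᵐ p ∂(Measure.infinitePi fun _ : ℤ => ν).prod μ, p ∉ A := by
  set Q := Measure.infinitePi fun _ : ℤ => ν with hQ
  have hH : MeasurableSet {x | Q ((fun w => (w, x)) ⁻¹' A) = 1} :=
    (measurable_measure_prodMk_right hA) (measurableSet_singleton 1)
  set H := {x | Q ((fun w => (w, x)) ⁻¹' A) = 1} with hHdef
  have hAH : ∀ᵐ p ∂Q.prod μ, p ∈ A ↔ p.2 ∈ H := by
    have hm : MeasurableSet {p : (ℤ → E) × X | p ∈ A ↔ p.2 ∈ H} :=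
      hA.iff (measurable_snd hH)
    refine (Measure.ae_prod_iff_ae_ae hm).2 ((Measure.ae_ae_comm hm).2 ?_)
    filter_upwards [ae_section_eq_zero_or_one hT hg ν hA hinv] with x hx
    rcases hx with hx | hx
    · filter_upwards [measure_eq_zero_iff_ae_notMem.1 hx] with w hw
      refine iff_of_false hw fun (hxH : Q _ = 1) => ?_
      rw [hx] at hxH
      exact zero_ne_one hxH
    · filter_upwards [(prob_compl_eq_zero_iff (measurable_prodMk_right hA)).2 hx] with w hw
      exact iff_of_true hw hx
  -- One skew shift leaves membership in `A` unchanged and moves `x` by the step `g (p.1 0)`.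
  have hstep : ∀ᵐ p ∂Q.prod μ, T (g (p.1 0)) p.2 ∈ H ↔ p.2 ∈ H := by
    filter_upwards [hAH, (measurePreserving_skewShift hT hg ν 1).quasiMeasurePreserving.ae hAH]
      with p h1 h2
    have h3 : skewShift g T 1 p ∈ A ↔ p ∈ A := by
      conv_rhs => rw [← hinv 1]
      rfl
    have h4 : (skewShift g T 1 p).2 = T (g (p.1 0)) p.2 := by
      have := position_add_one (fun i => g (p.1 i)) 0
      rw [zero_add, position_zero, zero_add] at this
      simp only [skewShift, this]
    rw [← h1, ← h3, h2, h4]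
  have hmap : Q.map (fun w => g (w 0)) = ν.map g := by
    rw [← Measure.infinitePi_map_eval (fun _ : ℤ => ν) 0,
      Measure.map_map hg (measurable_pi_apply _)]
    rfl
  have : IsProbabilityMeasure (ν.map g) := Measure.isProbabilityMeasure_map hg.aemeasurable
  have hae : ∀ᵐ a ∂ν.map g, ∀ᵐ x ∂μ, T a x ∈ H ↔ x ∈ H := by
    rw [← hmap]
    have hm : MeasurableSet {p : ℝ × X | T p.1 p.2 ∈ H ↔ p.2 ∈ H} :=
      (hT.measurable hH).iff (measurable_snd hH)
    have hm' : MeasurableSet {a : ℝ | ∀ᵐ x ∂μ, T a x ∈ H ↔ x ∈ H} :=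
      (measurable_measure_prodMk_left (ν := μ) hm.compl) (measurableSet_singleton 0)
    refine (ae_map_iff (hg.comp (measurable_pi_apply 0)).aemeasurable hm').2 ?_
    exact Measure.ae_ae_of_ae_prod hstep
  rcases hT.ae_mem_or_ae_notMem_of_atomless hH hν hae with h | h
  · left
    filter_upwards [hAH, Measure.quasiMeasurePreserving_snd.ae h] with p h1 h2
    exact h1.2 h2
  · right
    filter_upwards [hAH, Measure.quasiMeasurePreserving_snd.ae h] with p h1 h2
    exact fun hp => h2 (h1.1 hp)

end PointProc

/-! ### Measurability of the shift and configurations built from gaps and marks -/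

namespace PointProc
open Set Filter Topology
open scoped ENNReal

variable {M : Type*} [MeasurableSpace M]

theorem shift_val (τ : ℝ) (N : CountingMeasure M) : (shift τ N).1 = N.1.map (movePoint M τ) := rfl

theorem shift_zero (N : CountingMeasure M) : shift 0 N = N := by
  refine Subtype.ext ?_
  have : movePoint M 0 = id := by ext x <;> simp [movePoint]
  simp [shift, this]

theorem shift_add (s t : ℝ) (N : CountingMeasure M) : shift (s + t) N = shift s (shift t N) := by
  refine Subtype.ext ?_
  simp only [shift]
  rw [Measure.map_map (measurable_movePoint s) (measurable_movePoint t)]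
  congr 1
  ext x
  · simp only [movePoint, Function.comp]; ring
  · rfl

theorem image_shift (τ : ℝ) (Z : Set (CountingMeasure M)) : shift τ '' Z = shift (-τ) ⁻¹' Z := by
  refine congrFun (image_eq_preimage_of_inverse (fun N => ?_) (fun N => ?_)) Z
  · rw [← shift_add, neg_add_cancel, shift_zero]
  · rw [← shift_add, add_neg_cancel, shift_zero]

theorem measurable_shift :
    Measurable fun p : ℝ × CountingMeasure M => shift p.1 p.2 := by
  refine Measurable.subtype_mk (Measure.measurable_of_measurable_coe _ fun E hE => ?_)
  -- A counting measure may be infinite; cut into unit time strips it yields finite kernels, whose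
  -- sections depend measurably on the parameter.
  let R : ℤ → Set (ℝ × M) := fun n => Ico (n : ℝ) (n + 1) ×ˢ univ
  have hR : ∀ n, MeasurableSet (R n) := fun n => measurableSet_Ico.prod MeasurableSet.univ
  let κ₀ : Kernel (ℝ × CountingMeasure M) (ℝ × M) :=
    ⟨fun p => p.2.1, measurable_subtype_coe.comp measurable_snd⟩
  let κ : ℤ → Kernel (ℝ × CountingMeasure M) (ℝ × M) := fun n => κ₀.restrict (hR n)
  have hκ : ∀ n p, IsFiniteMeasure (κ n p) := fun n p => ⟨by
    change p.2.1.restrict (R n) univ < ⊤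
    rw [Measure.restrict_apply_univ]
    exact p.2.2.2 _ measurableSet_Ico (Metric.isBounded_Ico _ _)⟩
  have hF : MeasurableSet {q : (ℝ × CountingMeasure M) × (ℝ × M) | movePoint M q.1.1 q.2 ∈ E} := by
    have : Measurable fun q : (ℝ × CountingMeasure M) × (ℝ × M) => movePoint M q.1.1 q.2 := by
      unfold movePoint
      fun_prop
    exact this hE
  have hsum : ∀ p : ℝ × CountingMeasure M, p.2.1.map (movePoint M p.1) E =
      ∑' n, κ n p (Prod.mk p ⁻¹' {q | movePoint M q.1.1 q.2 ∈ E}) := by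
    intro p
    have hpre : MeasurableSet (movePoint M p.1 ⁻¹' E) := measurable_movePoint p.1 hE
    rw [Measure.map_apply (measurable_movePoint p.1) hE]
    change _ = ∑' n, p.2.1.restrict (R n) (movePoint M p.1 ⁻¹' E)
    simp_rw [Measure.restrict_apply hpre]
    rw [← measure_iUnion, ← inter_iUnion]
    · congr 1
      refine (inter_eq_left.2 fun x _ => mem_iUnion.2 ⟨⌊x.1⌋, ?_⟩).symm
      exact ⟨⟨Int.floor_le _, Int.lt_floor_add_one _⟩, mem_univ _⟩
    · intro i j hij
      have h1 : Disjoint (Ico (i : ℝ) (i + 1)) (Ico (j : ℝ) (j + 1)) := by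
        refine disjoint_left.2 fun x hi hj => hij ?_
        rw [← Int.floor_eq_iff.2 hi, ← Int.floor_eq_iff.2 hj]
      refine disjoint_left.2 fun x hx hx' => ?_
      exact disjoint_left.1 h1 hx.2.1 hx'.2.1
    · exact fun i => hpre.inter (hR i)
  simp only [hsum]
  exact Measurable.tsum fun n =>
    Kernel.measurable_kernel_prodMk_left_of_finite hF (hκ n)

theorem measurable_shift_const (τ : ℝ) : Measurable (shift τ : CountingMeasure M → _) :=
  measurable_shift.comp measurable_prodMk_left

/-- The sum of the unit masses at the points `position i` with the marks of the sequence. -/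
noncomputable def rawConfig (w : ℤ → ℝ × M) : Measure (ℝ × M) :=
  Measure.sum fun i => Measure.dirac (position (fun j => (w j).1) i, (w i).2)

theorem measurable_rawConfig : Measurable (rawConfig (M := M)) := by
  refine Measure.measurable_of_measurable_coe _ fun E hE => ?_
  simp only [rawConfig, Measure.sum_apply _ hE]
  refine Measurable.tsum fun i => (Measure.measurable_coe hE).comp
    (Measure.measurable_dirac.comp (Measurable.prodMk ?_ (measurable_pi_apply i).snd))
  exact measurable_position fun j _ => (measurable_pi_apply j).fst

theorem sum_dirac_apply_eq_encard {ι α : Type*} [MeasurableSpace α] (f : ι → α) {E : Set α}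
    (hE : MeasurableSet E) :
    (Measure.sum fun i => Measure.dirac (f i)) E = ((f ⁻¹' E).encard : ℝ≥0∞) := by
  rw [Measure.sum_apply _ hE, ← ENNReal.tsum_set_one, tsum_subtype (f ⁻¹' E) fun _ => (1 : ℝ≥0∞)]
  refine tsum_congr fun i => ?_
  rw [Measure.dirac_apply' _ hE]
  rfl

/-- Local finiteness in time of a measure on time-mark pairs. -/
def IsFiniteOnBounded (N : Measure (ℝ × M)) : Prop :=
  ∀ B : Set ℝ, MeasurableSet B → Bornology.IsBounded B → N (B ×ˢ Set.univ) < ⊤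

theorem isFiniteOnBounded_iff (N : Measure (ℝ × M)) :
    IsFiniteOnBounded N ↔ ∀ n : ℕ, N (Icc (-n : ℝ) n ×ˢ univ) < ⊤ := by
  refine ⟨fun h n => h _ measurableSet_Icc (Metric.isBounded_Icc _ _), fun h B _ hb => ?_⟩
  obtain ⟨C, hC⟩ := hb.exists_norm_le
  obtain ⟨n, hn⟩ := exists_nat_ge C
  refine (measure_mono (Set.prod_mono (fun t ht => ?_) le_rfl)).trans_lt (h n)
  exact abs_le.1 ((hC t ht).trans hn)

theorem measurableSet_isFiniteOnBounded :
    MeasurableSet {w : ℤ → ℝ × M | IsFiniteOnBounded (rawConfig w)} := by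
  simp only [isFiniteOnBounded_iff, ofPred_forall]
  refine MeasurableSet.iInter fun n => ?_
  exact ((Measure.measurable_coe (measurableSet_Icc.prod MeasurableSet.univ)).comp
    measurable_rawConfig) measurableSet_Iio

open Classical in
/-- The counting measure with the given gaps and marks and point `0` at the origin; the zero
measure if the points accumulate. -/
noncomputable def config (w : ℤ → ℝ × M) : CountingMeasure M :=
  ⟨if IsFiniteOnBounded (rawConfig w) then rawConfig w else 0, by
    split_ifs with h
    · exact ⟨fun E hE => ⟨_, sum_dirac_apply_eq_encard _ hE⟩, h⟩
    · exact ⟨fun E _ => ⟨0, by simp⟩, fun B _ _ => by simp⟩⟩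

theorem config_val {w : ℤ → ℝ × M} (h : IsFiniteOnBounded (rawConfig w)) :
    (config w).1 = rawConfig w := if_pos h

theorem config_val_of_not {w : ℤ → ℝ × M} (h : ¬ IsFiniteOnBounded (rawConfig w)) :
    (config w).1 = 0 := if_neg h

theorem measurable_config : Measurable (config (M := M)) := by
  classical
  exact Measurable.subtype_mk
    (Measurable.ite measurableSet_isFiniteOnBounded measurable_rawConfig measurable_const)

theorem map_movePoint_sum_dirac {ι : Type*} [Countable ι] (f : ι → ℝ × M) (τ : ℝ) :
    (Measure.sum fun i => Measure.dirac (f i)).map (movePoint M τ) =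
      Measure.sum fun i => Measure.dirac (movePoint M τ (f i)) := by
  rw [Measure.map_sum (measurable_movePoint τ).aemeasurable]
  simp only [Measure.map_dirac' (measurable_movePoint τ)]

theorem rawConfig_comp_add (w : ℤ → ℝ × M) (m : ℤ) :
    rawConfig (fun i => w (i + m)) =
      (rawConfig w).map (movePoint M (position (fun j => (w j).1) m)) := by
  rw [rawConfig, rawConfig, map_movePoint_sum_dirac]
  have h := fun i => position_comp_add (fun j => (w j).1) m i
  simp only [movePoint, h]
  ext E hE
  rw [Measure.sum_apply _ hE, Measure.sum_apply _ hE]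
  exact (Equiv.addRight m).tsum_eq fun i => (Measure.dirac
    (position (fun j => (w j).1) i - position (fun j => (w j).1) m, (w i).2)) E

theorem IsFiniteOnBounded.comp_add {w : ℤ → ℝ × M} (h : IsFiniteOnBounded (rawConfig w)) (m : ℤ) :
    IsFiniteOnBounded (rawConfig fun i => w (i + m)) := by
  have h1 := (shift (position (fun j => (w j).1) m) (config w)).2.2
  rw [shift_val, config_val h, ← rawConfig_comp_add] at h1
  exact h1

theorem config_comp_add (w : ℤ → ℝ × M) (m : ℤ) :
    config (fun i => w (i + m)) = shift (position (fun j => (w j).1) m) (config w) := by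
  refine Subtype.ext ?_
  by_cases h : IsFiniteOnBounded (rawConfig w)
  · rw [config_val (h.comp_add m), shift_val, config_val h, rawConfig_comp_add]
  · have h' : ¬ IsFiniteOnBounded (rawConfig fun i => w (i + m)) := by
      intro h'
      refine h ?_
      simpa using h'.comp_add (-m)
    rw [config_val_of_not h', shift_val, config_val_of_not h, Measure.map_zero]

end PointProc

/-! ### The interval covering the origin -/

namespace PointProc
open Set Filter Topology
open scoped ENNReal

variable {M : Type*} [MeasurableSpace M]

/-- Recovers a distance from a countable infimum, so that the recurrence times are measurable. -/
theorem iInf_rat_ite_le (c : ℝ) :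
    ⨅ q : ℚ, (if c ≤ q then ENNReal.ofReal q else ⊤) = ENNReal.ofReal c := by
  refine le_antisymm ?_ (le_iInf fun q => ?_)
  · refine ENNReal.le_of_forall_pos_le_add fun ε hε _ => ?_
    obtain ⟨q, hq1, hq2⟩ := exists_rat_btwn (show c < c + ε by simpa using hε)
    refine (iInf_le _ q).trans ?_
    rw [if_pos hq1.le]
    refine (ENNReal.ofReal_le_ofReal hq2.le).trans ?_
    refine ENNReal.ofReal_add_le.trans ?_
    simp
  · split_ifs with h
    · exact ENNReal.ofReal_le_ofReal h
    · exact le_top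

/-- The distance from the origin back to the last point in `(-∞, 0]`. -/
noncomputable def backwardRecurrence (N : CountingMeasure M) : ℝ≥0∞ :=
  ⨅ q : ℚ, if 0 < N.1 (Icc (-q : ℝ) 0 ×ˢ univ) then ENNReal.ofReal q else ⊤

/-- The distance from the origin to the first point in `(0, ∞)`. -/
noncomputable def forwardRecurrence (N : CountingMeasure M) : ℝ≥0∞ :=
  ⨅ q : ℚ, if 0 < N.1 (Ioc (0 : ℝ) q ×ˢ univ) then ENNReal.ofReal q else ⊤

/-- The length of the interval between consecutive points that covers the origin. -/
noncomputable def coverLength (N : CountingMeasure M) : ℝ :=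
  (backwardRecurrence N).toReal + (forwardRecurrence N).toReal

theorem measurable_coverLength : Measurable (coverLength (M := M)) := by
  have h : ∀ B : Set ℝ, MeasurableSet B →
      MeasurableSet {N : CountingMeasure M | 0 < N.1 (B ×ˢ univ)} := fun B hB =>
    ((Measure.measurable_coe (hB.prod MeasurableSet.univ)).comp measurable_subtype_coe)
      measurableSet_Ioi
  refine Measurable.add (Measurable.ennreal_toReal ?_) (Measurable.ennreal_toReal ?_)
  · exact Measurable.iInf fun q =>
      Measurable.ite (h _ measurableSet_Icc) measurable_const measurable_const
  · exact Measurable.iInf fun q =>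
      Measurable.ite (h _ measurableSet_Ioc) measurable_const measurable_const

/-- The index `i` is arbitrary because after a time shift the origin falls into another gap. -/
theorem coverLength_eq {N : CountingMeasure M} {t : ℤ → ℝ} {s : ℤ → M} (ht : Monotone t)
    (hN : N.1 = Measure.sum fun i => Measure.dirac (t i, s i)) {i : ℤ} (h0 : t i ≤ 0)
    (h1 : 0 < t (i + 1)) : coverLength N = t (i + 1) - t i := by
  have hpos : ∀ B : Set ℝ, MeasurableSet B → (0 < N.1 (B ×ˢ univ) ↔ ∃ j, t j ∈ B) := by
    intro B hB
    rw [hN, sum_dirac_apply_eq_encard _ (hB.prod MeasurableSet.univ)]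
    rw [pos_iff_ne_zero, ne_eq, ENat.toENNReal_eq_zero, encard_eq_zero, ← ne_eq,
      ← nonempty_iff_ne_empty]
    exact exists_congr fun j => ⟨fun h => h.1, fun h => ⟨h, mem_univ _⟩⟩
  have hlt : ∀ j, t j ≤ 0 → t j ≤ t i := by
    intro j hj
    refine ht ?_
    by_contra! hij
    exact absurd (ht (Int.add_one_le_of_lt hij)) (not_le.2 (hj.trans_lt h1))
  have hgt : ∀ j, 0 < t j → t (i + 1) ≤ t j := by
    intro j hj
    refine ht (Int.add_one_le_of_lt ?_)
    by_contra! hij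
    exact absurd (ht hij) (not_le.2 (h0.trans_lt hj))
  have hb : backwardRecurrence N = ENNReal.ofReal (-t i) := by
    rw [← iInf_rat_ite_le, backwardRecurrence]
    refine iInf_congr fun q => if_congr ((hpos _ measurableSet_Icc).trans ?_) rfl rfl
    refine ⟨fun ⟨j, hj⟩ => ?_, fun h => ⟨i, by linarith, h0⟩⟩
    have := hlt j hj.2
    linarith [hj.1]
  have hf : forwardRecurrence N = ENNReal.ofReal (t (i + 1)) := by
    rw [← iInf_rat_ite_le, forwardRecurrence]
    refine iInf_congr fun q => if_congr ((hpos _ measurableSet_Ioc).trans ?_) rfl rfl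
    exact ⟨fun ⟨j, hj⟩ => (hgt j hj.1).trans hj.2, fun h => ⟨i + 1, h1, h⟩⟩
  rw [coverLength, hb, hf, ENNReal.toReal_ofReal (by linarith), ENNReal.toReal_ofReal h1.le]
  ring

/-- In a locally finite ordered configuration, every time after the first positive point lies
between two consecutive positive points. -/
theorem exists_cover {N : CountingMeasure M} {t : ℤ → ℝ} {s : ℤ → M} (ht : Monotone t)
    (hN : N.1 = Measure.sum fun i => Measure.dirac (t i, s i)) (h1 : 0 < t 1) {u : ℝ}
    (hu : t 1 ≤ u) : ∃ i : ℤ, 1 ≤ i ∧ t i ≤ u ∧ u < t (i + 1) := by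
  classical
  have hex : ∃ k : ℕ, u < t (k + 1) := by
    by_contra! hcon
    have hfin := N.2.2 (Ioc 0 u) measurableSet_Ioc (Metric.isBounded_Ioc _ _)
    rw [hN, sum_dirac_apply_eq_encard _ (measurableSet_Ioc.prod MeasurableSet.univ)] at hfin
    have hsub : range (fun k : ℕ => (k : ℤ) + 1) ⊆
        (fun i => (t i, s i)) ⁻¹' (Ioc 0 u ×ˢ univ) := by
      rintro _ ⟨k, rfl⟩
      exact ⟨⟨h1.trans_le (ht (by lia)), hcon k⟩, mem_univ _⟩
    have hinf : (range (fun k : ℕ => (k : ℤ) + 1)).Infinite :=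
      infinite_range_of_injective fun a b hab => by simpa using hab
    rw [(hinf.mono hsub).encard_eq] at hfin
    simp at hfin
  -- The predicate at `k` concerns `t (k + 1)`, so the value `0` would mean `u < t 1`.
  have h0 : Nat.find hex ≠ 0 := by
    intro h
    have := Nat.find_spec hex
    rw [h] at this
    simp only [Nat.cast_zero, zero_add] at this
    linarith
  refine ⟨Nat.find hex, by lia, ?_, Nat.find_spec hex⟩
  have := Nat.find_min hex (m := Nat.find hex - 1) (by lia)
  rw [not_lt] at this
  have hk : ((Nat.find hex - 1 : ℕ) : ℤ) + 1 = (Nat.find hex : ℤ) := by lia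
  rwa [hk] at this

variable {Ω : Type*} [MeasurableSpace Ω] {P : Measure Ω} [IsProbabilityMeasure P]

/-- In a stationary renewal process the distribution of the interval covering the origin is
absolutely continuous with respect to the inter-arrival distribution. -/
theorem absolutelyContinuous_coverInterval {Φ : PointProcess Ω M} {PA : Measure ℝ}
    (hΦ : Φ.IsStationary P) {T : ℤ → Ω → ℝ} {S : ℤ → Ω → M} (hTm : ∀ i, Measurable (T i))
    (hT : ∀ᵐ ω ∂P, Monotone (fun i => T i ω) ∧ T 0 ω ≤ 0 ∧ 0 < T 1 ω ∧
      (Φ.toFun ω).1 = Measure.sum fun i : ℤ => Measure.dirac (T i ω, S i ω))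
    (hlaw : ∀ i : ℤ, i ≠ 1 → HasLaw (fun ω => T i ω - T (i - 1) ω) PA P) :
    P.map (fun ω => T 1 ω - T 0 ω) ≪ PA := by
  refine Measure.AbsolutelyContinuous.mk fun B hB hPA => ?_
  have hZ : MeasurableSet (coverLength (M := M) ⁻¹' B) := measurable_coverLength hB
  have hLm : Measurable fun ω => T 1 ω - T 0 ω := (hTm 1).sub (hTm 0)
  rw [Measure.map_apply hLm hB]
  have h1 : P ((fun ω => T 1 ω - T 0 ω) ⁻¹' B) ≤ Φ.law P (coverLength ⁻¹' B) := by
    rw [PointProcess.law, Measure.map_apply Φ.measurable_toFun hZ]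
    refine measure_mono_ae ?_
    filter_upwards [hT] with ω hω hB'
    change coverLength (Φ.toFun ω) ∈ B
    rw [coverLength_eq hω.1 hω.2.2.2 (i := 0) hω.2.1 hω.2.2.1]
    exact hB'
  have hgap : ∀ᵐ ω ∂P, ∀ i : ℤ, i ≠ 1 → T i ω - T (i - 1) ω ∉ B := by
    refine ae_all_iff.2 fun i => ?_
    by_cases hi : i = 1
    · simp [hi]
    · simp only [ne_eq, hi, not_false_eq_true, forall_const]
      change ∀ᵐ ω ∂P, ω ∉ (fun ω => T i ω - T (i - 1) ω) ⁻¹' B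
      refine measure_eq_zero_iff_ae_notMem.1 ?_
      have hm : Measurable fun ω => T i ω - T (i - 1) ω := (hTm i).sub (hTm _)
      rw [← Measure.map_apply hm hB, (hlaw i hi).map_eq, hPA]
  -- By stationarity the interval covering time `n` may be examined instead. If `T 1 ω ≤ n`, it is
  -- an ordinary gap, whose length almost surely avoids the `PA`-null set `B`.
  have h2 : ∀ n : ℕ, Φ.law P (coverLength ⁻¹' B) ≤ P {ω | (n : ℝ) < T 1 ω} := by
    intro n
    rw [← hΦ _ hZ (-n), image_shift, neg_neg, PointProcess.law,
      Measure.map_apply Φ.measurable_toFun (measurable_shift_const _ hZ)]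
    refine measure_mono_ae ?_
    filter_upwards [hT, hgap] with ω hω hg hB'
    change (n : ℝ) < T 1 ω
    change coverLength (shift n (Φ.toFun ω)) ∈ B at hB'
    by_contra! hle
    obtain ⟨i, hi1, hi2, hi3⟩ := exists_cover hω.1 hω.2.2.2 hω.2.2.1 hle
    have hN : (shift n (Φ.toFun ω)).1 =
        Measure.sum fun i : ℤ => Measure.dirac (T i ω - n, S i ω) := by
      rw [shift_val, hω.2.2.2, map_movePoint_sum_dirac]
      rfl
    rw [coverLength_eq (t := fun i => T i ω - n) (fun i j hij => sub_le_sub_right (hω.1 hij) _) hN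
      (i := i) (by linarith) (by linarith)] at hB'
    refine hg (i + 1) (by lia) ?_
    rw [add_sub_cancel_right]
    simpa using hB'
  have h3 : Tendsto (fun n : ℕ => P {ω | (n : ℝ) < T 1 ω}) atTop (𝓝 0) := by
    have := tendsto_measure_iInter_atTop (μ := P) (s := fun n : ℕ => {ω | (n : ℝ) < T 1 ω})
      (fun n => (measurableSet_lt measurable_const (hTm 1)).nullMeasurableSet)
      (fun m n hmn ω (hω : (n : ℝ) < T 1 ω) =>
        lt_of_le_of_lt (Nat.cast_le.2 hmn) hω) ⟨0, measure_ne_top _ _⟩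
    have hempty : ⋂ n : ℕ, {ω | (n : ℝ) < T 1 ω} = ∅ := by
      refine eq_empty_of_forall_notMem fun ω hω => ?_
      obtain ⟨n, hn⟩ := exists_nat_ge (T 1 ω)
      exact absurd (mem_iInter.1 hω n) (not_lt.2 hn)
    rwa [hempty, measure_empty] at this
  exact le_antisymm (h1.trans (ge_of_tendsto h3 (.of_forall h2))) zero_le

/-! ### Comparison with an i.i.d. sequence of gaps and marks -/

/-- Merge a sequence of gaps and a sequence of marks. -/
def zipSeq (p : (ℤ → ℝ) × (ℤ → M)) (i : ℤ) : ℝ × M := (p.1 i, p.2 i)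

theorem measurable_zipSeq : Measurable (zipSeq (M := M)) :=
  measurable_pi_lambda _ fun i =>
    ((measurable_pi_apply i).comp measurable_fst).prodMk
      ((measurable_pi_apply i).comp measurable_snd)

theorem map_zipSeq (PA : Measure ℝ) (PS : Measure M) [IsProbabilityMeasure PA]
    [IsProbabilityMeasure PS] :
    ((Measure.infinitePi fun _ : ℤ => PA).prod (Measure.infinitePi fun _ : ℤ => PS)).map zipSeq =
      Measure.infinitePi fun _ : ℤ => PA.prod PS := by
  refine IsProjectiveLimit.unique (P := fun I : Finset ℤ => Measure.pi fun _ : I => PA.prod PS)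
    (fun I => ?_) (Measure.isProjectiveLimit_infinitePi fun _ : ℤ => PA.prod PS)
  have h1 := (measurePreserving_arrowProdEquivProdArrow ℝ M I (fun _ => PA) (fun _ => PS)).symm
  change _ = Measure.pi fun _ : I => PA.prod PS
  rw [Measure.map_map (Finset.measurable_restrict I) measurable_zipSeq, ← h1.map_eq,
    ← Measure.infinitePi_map_restrict (fun _ : ℤ => PA),
    ← Measure.infinitePi_map_restrict (fun _ : ℤ => PS),
    Measure.map_prod_map _ _ (Finset.measurable_restrict I) (Finset.measurable_restrict I),
    Measure.map_map h1.measurable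
      ((Finset.measurable_restrict I).prodMap (Finset.measurable_restrict I))]
  rfl

/-- Insert the gap covering the origin into the sequence of the other gaps. -/
def insertGap (p : ℝ × ({i : ℤ // i ≠ 1} → ℝ)) (i : ℤ) : ℝ :=
  -- Entry `i` is the distance from point `i` to point `i + 1`, that is, inter-arrival time `i + 1`;
  -- the exceptional one sits at index `0`.
  if h : i + 1 = 1 then p.1 else p.2 ⟨i + 1, h⟩

theorem measurable_insertGap : Measurable insertGap := by
  refine measurable_pi_lambda _ fun i => ?_
  unfold insertGap
  split_ifs with h
  · exact measurable_fst
  · exact (measurable_pi_apply _).comp measurable_snd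

/-- Under the i.i.d. law, coordinate `0` is independent of the others, and `insertGap` reassembles
them. -/
theorem map_insertGap (PA : Measure ℝ) [IsProbabilityMeasure PA] :
    (PA.prod (Measure.infinitePi fun _ : {i : ℤ // i ≠ 1} => PA)).map insertGap =
      Measure.infinitePi fun _ : ℤ => PA := by
  have hinj : Function.Injective fun i : {i : ℤ // i ≠ 1} => (i : ℤ) - 1 :=
    fun a b hab => Subtype.ext (by simpa using hab)
  have hind : IndepFun (fun w : ℤ → ℝ => w 0)
      (fun (w : ℤ → ℝ) (i : {i : ℤ // i ≠ 1}) => w ((i : ℤ) - 1))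
      (Measure.infinitePi fun _ : ℤ => PA) := by
    refine (IndepFun_iff_Indep _ _ _).2 (indep_of_indep_of_le_left (indep_of_indep_of_le_right
      (indep_coordSigma PA (disjoint_compl_right (a := ({0} : Set ℤ)))) ?_) ?_)
    · refine measurable_iff_comap_le.1 (@measurable_pi_lambda _ _ _ (coordSigma ℝ _) _ _ fun i => ?_)
      refine measurable_coord ?_
      have := i.2
      simp only [mem_compl_iff, mem_singleton_iff]
      lia
    · exact measurable_iff_comap_le.1 (measurable_coord rfl)
  have hm1 : Measurable fun w : ℤ → ℝ => w 0 := measurable_pi_apply 0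
  have hm2 : Measurable fun (w : ℤ → ℝ) (i : {i : ℤ // i ≠ 1}) => w ((i : ℤ) - 1) :=
    measurable_pi_lambda _ fun i => measurable_pi_apply _
  have h := hind.map_prod_eq_prod_map_map hm1.aemeasurable hm2.aemeasurable
  rw [Measure.infinitePi_map_eval,
    Measure.map_infinitePi_infinitePi_of_inj (P := fun _ : ℤ => PA) hinj] at h
  rw [← h, Measure.map_map measurable_insertGap (hm1.prodMk hm2)]
  convert Measure.map_id using 2
  funext w i
  simp only [insertGap, Function.comp, id]
  split_ifs with hi
  · congr 1; lia
  · simp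

/-- In a stationary renewal process with independent marks, the law of the sequence of gaps and
marks is absolutely continuous with respect to the law of an i.i.d. sequence. -/
theorem absolutelyContinuous_gapsMarks {PA : Measure ℝ} {PS : Measure M}
    {T : ℤ → Ω → ℝ} {S : ℤ → Ω → M} (hTm : ∀ i, Measurable (T i)) (hSm : ∀ i, Measurable (S i))
    [IsProbabilityMeasure PA] [IsProbabilityMeasure PS]
    (hcover : P.map (fun ω => T 1 ω - T 0 ω) ≪ PA)
    (hlaw : ∀ i : ℤ, i ≠ 1 → HasLaw (fun ω => T i ω - T (i - 1) ω) PA P)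
    (hindep : iIndepFun (fun (i : {i : ℤ // i ≠ 1}) ω => T i ω - T (i - 1) ω) P)
    (hindep' : IndepFun (fun ω => (T 0 ω, T 1 ω))
      (fun ω (i : {i : ℤ // i ≠ 1}) => T i ω - T (i - 1) ω) P)
    (hS : ∀ i, HasLaw (S i) PS P) (hSindep : iIndepFun S P)
    (hTS : IndepFun (fun ω i => T i ω) (fun ω i => S i ω) P) :
    P.map (fun ω i => (T (i + 1) ω - T i ω, S i ω)) ≪
      Measure.infinitePi fun _ : ℤ => PA.prod PS := by
  have hgm : Measurable fun ω (i : ℤ) => T (i + 1) ω - T i ω :=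
    measurable_pi_lambda _ fun i => (hTm _).sub (hTm _)
  have hsm : Measurable fun ω (i : ℤ) => S i ω := measurable_pi_lambda _ hSm
  have hrm : Measurable fun ω (i : {i : ℤ // i ≠ 1}) => T i ω - T (i - 1) ω :=
    measurable_pi_lambda _ fun i => (hTm _).sub (hTm _)
  have hlm : Measurable fun ω => T 1 ω - T 0 ω := (hTm 1).sub (hTm 0)
  have hgaps : P.map (fun ω (i : ℤ) => T (i + 1) ω - T i ω) ≪
      Measure.infinitePi fun _ : ℤ => PA := by
    have hi : IndepFun (fun ω => T 1 ω - T 0 ω)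
        (fun ω (i : {i : ℤ // i ≠ 1}) => T i ω - T (i - 1) ω) P :=
      hindep'.comp (φ := fun p : ℝ × ℝ => p.2 - p.1) (measurable_snd.sub measurable_fst)
        measurable_id
    have hrest : P.map (fun ω (i : {i : ℤ // i ≠ 1}) => T i ω - T (i - 1) ω) =
        Measure.infinitePi fun _ => PA :=
      (iIndepFun.hasLaw_infinitePi (X := fun (i : {i : ℤ // i ≠ 1}) ω => T i ω - T (i - 1) ω)
        (fun i => hlaw i i.2) hindep hrm.aemeasurable).map_eq
    have heq : (fun ω (i : ℤ) => T (i + 1) ω - T i ω) = insertGap ∘ fun ω =>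
        (T 1 ω - T 0 ω, fun (i : {i : ℤ // i ≠ 1}) => T i ω - T (i - 1) ω) := by
      funext ω i
      simp only [insertGap, Function.comp]
      split_ifs with h
      · have : i = 0 := by lia
        simp [this]
      · simp
    rw [heq, ← Measure.map_map measurable_insertGap (hlm.prodMk hrm),
      hi.map_prod_eq_prod_map_map hlm.aemeasurable hrm.aemeasurable, hrest, ← map_insertGap PA]
    exact (hcover.prod Measure.AbsolutelyContinuous.rfl).map measurable_insertGap
  have hi : IndepFun (fun ω (i : ℤ) => T (i + 1) ω - T i ω) (fun ω i => S i ω) P :=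
    hTS.comp (φ := fun (t : ℤ → ℝ) i => t (i + 1) - t i)
      (measurable_pi_lambda _ fun i => (measurable_pi_apply _).sub (measurable_pi_apply _))
      measurable_id
  have hmarks := (hSindep.hasLaw_infinitePi (μ := fun _ => PS) hS hsm.aemeasurable).map_eq
  have heq : (fun ω (i : ℤ) => (T (i + 1) ω - T i ω, S i ω)) = zipSeq ∘ fun ω =>
      ((fun (i : ℤ) => T (i + 1) ω - T i ω), fun i => S i ω) := rfl
  rw [heq, ← Measure.map_map measurable_zipSeq (hgm.prodMk hsm),
    hi.map_prod_eq_prod_map_map hgm.aemeasurable hsm.aemeasurable, hmarks, ← map_zipSeq]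
  exact (hgaps.prod Measure.AbsolutelyContinuous.rfl).map measurable_zipSeq

end PointProc

/-! ### Factors, products with renewal processes, and joint ergodicity -/

namespace PointProc
open Set Filter Topology

variable {M : Type*} [MeasurableSpace M] {Ω : Type*} [MeasurableSpace Ω] {P : Measure Ω}
  {X : Type*} [MeasurableSpace X] {T : ℝ → X → X} {μ : Measure X}

/-- A factor of an ergodic flow is ergodic. -/
theorem IsErgodicFlow.of_factor {Y : Type*} [MeasurableSpace Y] {T' : ℝ → Y → Y} {ν : Measure Y}
    (hT : IsErgodicFlow T μ) {f : X → Y} (hf : MeasurePreserving f μ ν)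
    (hfT : ∀ t x, f (T t x) = T' t (f x)) (hmeas : Measurable fun p : ℝ × Y => T' p.1 p.2)
    (hzero : ∀ y, T' 0 y = y) (hadd : ∀ s t y, T' (s + t) y = T' s (T' t y)) :
    IsErgodicFlow T' ν where
  measurable := hmeas
  zero := hzero
  add := hadd
  preserving t := by
    have hm : Measurable (T' t) := hmeas.comp measurable_prodMk_left
    refine ⟨hm, ?_⟩
    rw [← hf.map_eq, Measure.map_map hm hf.measurable]
    have : T' t ∘ f = f ∘ T t := funext fun x => (hfT t x).symm
    rw [this, ← Measure.map_map hf.measurable (hT.preserving t).measurable,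
      (hT.preserving t).map_eq]
  ergodic A hA hinv := by
    rw [← hf.measure_preimage hA.nullMeasurableSet]
    refine hT.ergodic _ (hf.measurable hA) fun t => ?_
    rw [← preimage_comp, show f ∘ T t = T' t ∘ f from funext fun x => hfT t x, preimage_comp,
      hinv]

theorem PointProcess.IsStationary.measurePreserving {Φ : PointProcess Ω M}
    (h : Φ.IsStationary P) (τ : ℝ) : MeasurePreserving (shift τ) (Φ.law P) (Φ.law P) := by
  refine ⟨measurable_shift_const τ, Measure.ext fun Z hZ => ?_⟩
  rw [Measure.map_apply (measurable_shift_const τ) hZ, ← h Z hZ (-τ), image_shift, neg_neg]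

instance [IsProbabilityMeasure P] (Φ : PointProcess Ω M) : IsProbabilityMeasure (Φ.law P) :=
  Measure.isProbabilityMeasure_map Φ.measurable_toFun.aemeasurable

/-- The product of an ergodic flow with a stationary renewal process with atomless inter-arrival
distribution is ergodic. -/
theorem IsErgodicFlow.prod_renewal [IsProbabilityMeasure P] [IsProbabilityMeasure μ]
    (hT : IsErgodicFlow T μ) {Φ : PointProcess Ω M} {PA : Measure ℝ} {PS : Measure M}
    (hcont : ∀ t : ℝ, PA {t} = 0) (hΦ : Φ.IsRenewal P PA PS) (hstat : Φ.IsStationary P) :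
    IsErgodicFlow (fun τ (p : CountingMeasure M × X) => (shift τ p.1, T τ p.2))
      ((Φ.law P).prod μ) where
  measurable := by
    have h1 : Measurable fun p : ℝ × (CountingMeasure M × X) => shift p.1 p.2.1 :=
      measurable_shift.comp (measurable_fst.prodMk measurable_snd.fst)
    have h2 : Measurable fun p : ℝ × (CountingMeasure M × X) => T p.1 p.2.2 :=
      hT.measurable.comp (measurable_fst.prodMk measurable_snd.snd)
    exact h1.prodMk h2
  zero p := Prod.ext (shift_zero _) (hT.zero _)
  add s t p := Prod.ext (shift_add _ _ _) (hT.add _ _ _)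
  preserving t := (hstat.measurePreserving t).prod (hT.preserving t)
  ergodic Z hZ hinv := by
    obtain ⟨A, S, hAm, hSm, hae, hlaw, hindep, hindep', hS, hSindep, hAS⟩ := hΦ
    have : IsProbabilityMeasure PA :=
      (hlaw 0 zero_ne_one).map_eq ▸
        Measure.isProbabilityMeasure_map (hlaw 0 zero_ne_one).aemeasurable
    have : IsProbabilityMeasure PS :=
      (hS 0).map_eq ▸ Measure.isProbabilityMeasure_map (hS 0).aemeasurable
    have hcover := absolutelyContinuous_coverInterval hstat hAm hae hlaw
    have hac := absolutelyContinuous_gapsMarks hAm hSm hcover hlaw hindep hindep' hS hSindep hAS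
    have hWm : Measurable fun ω (i : ℤ) => (A (i + 1) ω - A i ω, S i ω) :=
      measurable_pi_lambda _ fun i => ((hAm _).sub (hAm _)).prodMk (hSm i)
    have hconfig : ∀ᵐ ω ∂P, config (fun i : ℤ => (A (i + 1) ω - A i ω, S i ω)) =
        shift (A 0 ω) (Φ.toFun ω) := by
      filter_upwards [hae] with ω hω
      have hpos : ∀ i, position (fun j => A (j + 1) ω - A j ω) i = A i ω - A 0 ω := fun i => by
        have := eq_add_position (t := fun i => A i ω) (a := fun j => A (j + 1) ω - A j ω)
          (fun i => by ring) i
        linarith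
      have hraw : rawConfig (fun i : ℤ => (A (i + 1) ω - A i ω, S i ω)) =
          (shift (A 0 ω) (Φ.toFun ω)).1 := by
        rw [shift_val, hω.2.2.2, map_movePoint_sum_dirac, rawConfig]
        simp only [hpos, movePoint]
      refine Subtype.ext ?_
      rw [config_val, hraw]
      intro B hB hb
      rw [hraw]
      exact (shift (A 0 ω) (Φ.toFun ω)).2.2 B hB hb
    -- Seeing the process from its point `0` shifts it by the random time `A 0`, so `x` must move by
    -- the same time. This depends on `ω` only, and each `T t` preserves `μ`.
    have hskew : MeasurePreserving (fun p : Ω × X => (p.1, T (A 0 p.1) p.2)) (P.prod μ)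
        (P.prod μ) :=
      (MeasurePreserving.id P).skew_product (g := fun ω x => T (A 0 ω) x)
        (hT.measurable.comp (((hAm 0).comp measurable_fst).prodMk measurable_snd))
        (.of_forall fun ω => (hT.preserving _).map_eq)
    -- An almost sure property under the i.i.d. law passes to the actual gaps and marks by absolute
    -- continuity; invariance of `C` then undoes the joint shift by `A 0`.
    have htransfer : ∀ C : Set (CountingMeasure M × X), MeasurableSet C →
        (∀ τ, (fun p : CountingMeasure M × X => (shift τ p.1, T τ p.2)) ⁻¹' C = C) →
        (∀ᵐ p ∂(Measure.infinitePi fun _ : ℤ => PA.prod PS).prod μ, (config p.1, p.2) ∈ C) →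
        ∀ᵐ p ∂(Φ.law P).prod μ, p ∈ C := by
      intro C hC hCinv h
      have h1 := (hac.prod (Measure.AbsolutelyContinuous.refl μ)).ae_le h
      have e1 : (P.map fun ω (i : ℤ) => (A (i + 1) ω - A i ω, S i ω)).prod μ =
          (P.prod μ).map (Prod.map (fun ω (i : ℤ) => (A (i + 1) ω - A i ω, S i ω)) id) := by
        rw [← Measure.map_prod_map _ _ hWm measurable_id, Measure.map_id]
      have e2 : (Φ.law P).prod μ = (P.prod μ).map (Prod.map Φ.toFun id) := by
        rw [← Measure.map_prod_map _ _ Φ.measurable_toFun measurable_id, Measure.map_id]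
        rfl
      rw [e1] at h1
      have h2 := ae_of_ae_map (hWm.prodMap measurable_id).aemeasurable h1
      rw [e2]
      refine (ae_map_iff (Φ.measurable_toFun.prodMap measurable_id).aemeasurable hC).2 ?_
      filter_upwards [hskew.quasiMeasurePreserving.ae h2,
        Measure.quasiMeasurePreserving_fst.ae hconfig] with p hp hp'
      rw [← hCinv (A 0 p.1)]
      simp only [Prod.map_apply, id_eq] at hp
      rw [hp'] at hp
      exact hp
    have hconfm : Measurable fun p : (ℤ → ℝ × M) × X => (config p.1, p.2) :=
      (measurable_config.comp measurable_fst).prodMk measurable_snd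
    -- Moving on by `m` indices is the joint time shift to the position of point `m`.
    have hskewinv : ∀ m, skewShift Prod.fst T m ⁻¹'
        ((fun p : (ℤ → ℝ × M) × X => (config p.1, p.2)) ⁻¹' Z) =
        (fun p : (ℤ → ℝ × M) × X => (config p.1, p.2)) ⁻¹' Z := by
      intro m
      ext p
      simp only [mem_preimage, skewShift, config_comp_add]
      conv_rhs => rw [← hinv (position (fun i => (p.1 i).1) m)]
      rfl
    have hmarg : ∀ t, (PA.prod PS).map Prod.fst {t} = 0 := fun t => by
      have : (PA.prod PS).map Prod.fst = PA := by simp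
      rw [this, hcont]
    rcases ae_mem_or_ae_notMem_of_skewShift_invariant hT measurable_fst (PA.prod PS) hmarg
      (hconfm hZ) hskewinv with h | h
    · exact Or.inr ((prob_compl_eq_zero_iff hZ).1 (htransfer Z hZ hinv h))
    · left
      refine measure_eq_zero_iff_ae_notMem.2 (htransfer Zᶜ hZ.compl (fun τ => ?_) h)
      rw [preimage_compl, hinv]

theorem measurable_shift_pi {K : ℕ} : Measurable
    fun p : ℝ × (Fin K → CountingMeasure M) => fun k => shift p.1 (p.2 k) :=
  measurable_pi_lambda _ fun k =>
    measurable_shift.comp (measurable_fst.prodMk ((measurable_pi_apply k).comp measurable_snd))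

/-- Independent stationary renewal processes with atomless inter-arrival distributions are jointly
ergodic. -/
theorem isErgodicFlow_pi_law [IsProbabilityMeasure P] (K : ℕ) (Φ : Fin K → PointProcess Ω M)
    (PA : Fin K → Measure ℝ) (PS : Fin K → Measure M) (hcont : ∀ k, ∀ t : ℝ, PA k {t} = 0)
    (hrenewal : ∀ k, (Φ k).IsRenewal P (PA k) (PS k)) (hstat : ∀ k, (Φ k).IsStationary P) :
    IsErgodicFlow (fun τ (N : Fin K → CountingMeasure M) k => shift τ (N k))
      (Measure.pi fun k => (Φ k).law P) := by
  induction K with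
  | zero =>
    refine ⟨measurable_shift_pi, fun N => funext fun k => shift_zero _,
      fun s t N => funext fun k => shift_add _ _ _,
      fun t => measurePreserving_pi _ _ fun k => (hstat k).measurePreserving t, fun A _ _ => ?_⟩
    -- With no processes the product is a one-point space, which starts the induction with a trivial
    -- ergodic flow.
    rcases Subsingleton.set_cases (p := fun A => A = ∅ ∨ A = univ) (Or.inl rfl) (Or.inr rfl) A
      with h | h
    · simp [h]
    · simp [h]
  | succ K ih =>
    have ih' := ih (fun k => Φ k.succ) (fun k => PA k.succ) (fun k => PS k.succ)
      (fun k => hcont _) (fun k => hrenewal _) (fun k => hstat _)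
    have hprod := ih'.prod_renewal (hcont 0) (hrenewal 0) (hstat 0)
    refine hprod.of_factor
      (f := (MeasurableEquiv.piFinSuccAbove (fun _ : Fin (K + 1) => CountingMeasure M) 0).symm)
      (measurePreserving_piFinSuccAbove (fun k => (Φ k).law P) 0).symm (fun t p => ?_)
      measurable_shift_pi
      (fun N => funext fun k => shift_zero _) (fun s t N => funext fun k => shift_add _ _ _)
    funext k
    refine Fin.cases ?_ (fun k => ?_) k <;> simp [MeasurableEquiv.piFinSuccAbove]

theorem superpose_shift {K : ℕ} (τ : ℝ) (N : Fin K → CountingMeasure M) :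
    superpose (fun k => shift τ (N k)) = shift τ (superpose N) := by
  refine Subtype.ext (Measure.ext fun E hE => ?_)
  have hm := measurable_movePoint (M := M) τ
  simp only [superpose, shift_val, Measure.finsetSum_apply, Measure.map_apply hm hE]

end PointProc

/-! ### The superposition as a factor of the joint process -/

theorem mainTheorem11 {Ω M : Type*} [MeasurableSpace Ω] [MeasurableSpace M]
    (P : Measure Ω) [IsProbabilityMeasure P] (K : ℕ)
    (Φ : Fin K → PointProc.PointProcess Ω M)
    (PA : Fin K → Measure ℝ) (PS : Fin K → Measure M)
    (hcont : ∀ k, ∀ t : ℝ, PA k {t} = 0)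
    (hrenewal : ∀ k, (Φ k).IsRenewal P (PA k) (PS k))
    (hindep : iIndepFun (fun k => (Φ k).toFun) P)
    (hstat : ∀ k, (Φ k).IsStationary P)
    (herg : ∀ k, (Φ k).IsErgodic P) :
    (PointProc.superposition Φ).IsStationary P ∧ (PointProc.superposition Φ).IsErgodic P := by
  have hm : Measurable fun ω k => (Φ k).toFun ω :=
    measurable_pi_lambda _ fun k => (Φ k).measurable_toFun
  have hjoint : P.map (fun ω k => (Φ k).toFun ω) = Measure.pi fun k => (Φ k).law P :=
    (iIndepFun_iff_map_fun_eq_pi_map fun k => (Φ k).measurable_toFun.aemeasurable).1 hindep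
  have hsuper : MeasurePreserving PointProc.superpose (Measure.pi fun k => (Φ k).law P)
      ((PointProc.superposition Φ).law P) := by
    refine ⟨PointProc.measurable_superpose, ?_⟩
    rw [← hjoint, Measure.map_map PointProc.measurable_superpose hm]
    rfl
  have hflow := (PointProc.isErgodicFlow_pi_law K Φ PA PS hcont hrenewal hstat).of_factor hsuper
    (fun t N => PointProc.superpose_shift t N) PointProc.measurable_shift PointProc.shift_zero
    PointProc.shift_add
  constructor
  · intro Z hZ τ
    rw [PointProc.image_shift, (hflow.preserving (-τ)).measure_preimage hZ.nullMeasurableSet]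
  · intro Z hZ hinv
    refine hflow.ergodic Z hZ fun τ => ?_
    have := hinv (-τ)
    rwa [PointProc.image_shift, neg_neg] at this
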